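/- Let $\mathsf{T}$ be a rigidly-compactly generated tensor triangulated category: a compactly generated triangulated category with a symmetric monoidal structure $(\otimes,\mathbf 1)$ that is exact and coproduct-preserving in each variable, whose compact objects form a rigid tensor subcategory. Let $\mathrm{Loc}^\otimes(\mathsf{T})$ be the complete lattice of localizing tensor-ideals of $\mathsf{T}$ ordered by inclusion, in which meets are intersections and the join of a family is the localizing tensor-ideal it generates, and write $\mathrm{loc}^\otimes(\mathcal{M})$ for the smallest localizing tensor-ideal containing a class $\mathcal{M}$ of objects. An idempotent algebra is a morphism $\eta\colon \mathbf 1\to A$ such that $A\otimes\eta$ is an isomorphism; it corresponds to the ideal $\ker(A\otimes -)=\{M \mid A\otimes M\cong 0\}$. An idempotent coalgebra is a morphism $\varepsilon\colon C\to\mathbf 1$ such that $C\otimes\varepsilon$ is an isomorphism; it corresponds to the ideal $\{M \mid C\otimes M\cong M\}$. Identify the set $\mathrm{Idem}(\mathsf{T})$ of idempotent algebras (up to isomorphism) with the set of localizing tensor-ideals of the form $\ker(A\otimes -)$. Let $F$ be a spatial frame, let $\mathrm{pt}(F)$ be its space of points $p\colon F\to\{0,1\}$, with open sets $U_f=\{p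 \mid p(f)=1\}$ for $f\in F$, and put $V_g=\mathrm{pt}(F)\setminus U_g$. Suppose that $F$ is $T_D$, i.e. every point of $\mathrm{pt}(F)$ is locally closed. Let $\tau\colon F\to \mathrm{Loc}^\otimes(\mathsf{T})$ be an injective map which preserves arbitrary joins and finite meets and factors through $\mathrm{Idem}(\mathsf{T})$. Then every $p\in\mathrm{pt}(F)$ admits $f,g\in F$ with $\{p\}=U_f\cap V_g$, an idempotent coalgebra $C_{\tau f}$ corresponding to $\tau f$ and an idempotent algebra $A_{\tau g}$ corresponding to $\tau g$. For each $p$ choose such data and an object $\Gamma_p\cong C_{\tau f}\otimes A_{\tau g}$. Whatever the choices, the map \[ \upsilon\colon \mathcal{P}(\mathrm{pt}(F))\to \mathrm{Loc}^\otimes(\mathsf{T}),\qquad \upsilon(W)=\mathrm{loc}^\otimes(\Gamma_p \mid p\in W), \] is a weak discretization of $\tau$, i.e. it preserves arbitrary joins, is injective, and for each $f\in F$ satisfies \[ \upsilon(U_f)=\bigvee_{x\in U_f}\upsilon(\{x\})\subseteq \tau(f). \] -/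

import Mathlib

open CategoryTheory CategoryTheory.Limits CategoryTheory.MonoidalCategory
open scoped ZeroObject

universe u v w

/-- An object `t` is compact if every morphism from `t` to a coproduct of a set-indexed family
factors through the coproduct of a finite subfamily. -/
def IsCompactObject {T : Type u} [Category.{v} T] [HasCoproducts.{v} T] (t : T) : Prop :=
  ∀ (J : Type v) (M : J → T) (f : t ⟶ ∐ M),
    ∃ (s : Finset J) (g : t ⟶ ∐ (fun j : s => M j.1)),
      g ≫ Sigma.desc (fun j : s => Sigma.ι M j.1) = f

/-- Rigidly-compactly generated tensor triangulated categories ("big tt-categories").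
The monoidal structure is symmetric, so that the conditions on `tensorLeft X` (that is, on
`X ⊗ -`) amount to the same conditions on the tensor product in each variable. -/
class BigTTCategory (T : Type u) [Category.{v} T] [HasZeroObject T] [HasShift T ℤ]
    [Preadditive T] [∀ n : ℤ, (shiftFunctor T n).Additive] [Pretriangulated T]
    [IsTriangulated T] [HasCoproducts.{v} T] [MonoidalCategory T] [SymmetricCategory T] :
    Prop where
  /-- `T` is generated by a set of compact objects. -/
  compactly_generated : ∃ (ι : Type v) (G : ι → T), (∀ i, IsCompactObject (G i)) ∧
    ∀ M : T, (∀ (i : ι) (n : ℤ) (f : G i ⟶ (shiftFunctor T n).obj M), f = 0) → IsZero M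
  /-- The tensor product is exact. -/
  tensor_exact : ∀ X : T, ∃ _ : (tensorLeft X).CommShift ℤ, (tensorLeft X).IsTriangulated
  /-- The tensor product preserves coproducts. -/
  tensor_coproducts : ∀ (X : T) (J : Type v),
    PreservesColimitsOfShape (Discrete J) (tensorLeft X)
  /-- The compact objects form a tensor subcategory. -/
  compact_unit : IsCompactObject (𝟙_ T)
  compact_tensor : ∀ X Y : T, IsCompactObject X → IsCompactObject Y → IsCompactObject (X ⊗ Y)
  /-- The tensor subcategory of compact objects is rigid: every compact object has a dual
  among the compact objects. -/
  compact_rigid : ∀ X : T, IsCompactObject X →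
    ∃ Y : T, IsCompactObject Y ∧ Nonempty (ExactPairing X Y)

/-- A localizing tensor-ideal: a (strictly) full triangulated subcategory, closed under
set-indexed coproducts and under tensoring with arbitrary objects. -/
@[ext]
structure LocIdeal (T : Type u) [Category.{v} T] [HasZeroObject T] [HasShift T ℤ]
    [Preadditive T] [∀ n : ℤ, (shiftFunctor T n).Additive] [Pretriangulated T]
    [HasCoproducts.{v} T] [MonoidalCategory T] where
  /-- membership in the ideal -/
  prop : ObjectProperty T
  iso_closed : prop.IsClosedUnderIsomorphisms
  triangulated : prop.IsTriangulated
  coproduct_mem : ∀ (J : Type v) (M : J → T), (∀ j, prop (M j)) → prop (∐ M)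
  tensor_mem : ∀ X M : T, prop M → prop (X ⊗ M)

namespace LocIdeal

section

variable {T : Type u} [Category.{v} T] [HasZeroObject T] [HasShift T ℤ]
    [Preadditive T] [∀ n : ℤ, (shiftFunctor T n).Additive] [Pretriangulated T]
    [HasCoproducts.{v} T] [MonoidalCategory T]

/-- Localizing ideals are ordered by inclusion. -/
instance : PartialOrder (LocIdeal T) := PartialOrder.lift LocIdeal.prop (fun _ _ => LocIdeal.ext)

/-- The intersection of a collection of localizing ideals. -/
instance : InfSet (LocIdeal T) where
  sInf S :=
    { prop := fun X => ∀ L ∈ S, L.prop X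
      iso_closed := ⟨fun e h L hL => L.iso_closed.of_iso e (h L hL)⟩
      triangulated :=
        { exists_zero := ⟨0, isZero_zero T, fun L _ =>
            haveI := L.iso_closed
            haveI := L.triangulated
            L.prop.prop_zero⟩
          isStableUnderShiftBy := fun a => ⟨fun X h L hL =>
            haveI := L.triangulated
            L.prop.le_shift a X (h L hL)⟩
          ext₂' := fun D hD h₁ h₃ => ObjectProperty.le_isoClosure _ _ (fun L hL =>
            haveI := L.iso_closed
            haveI := L.triangulated
            L.prop.ext_of_isTriangulatedClosed₂ D hD (h₁ L hL) (h₃ L hL)) }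
      coproduct_mem := fun J M h L hL => L.coproduct_mem J M (fun j => h j L hL)
      tensor_mem := fun X M h L hL => L.tensor_mem X M (h L hL) }

/-- The complete lattice `Loc^⊗(T)`: meets are intersections, and the join of a family is the
smallest localizing ideal containing all its members. -/
instance : CompleteLattice (LocIdeal T) :=
  completeLatticeOfInf (LocIdeal T) (fun _ =>
    ⟨fun _ hL _ h => h _ hL, fun _ hK X hX _ hL => hK hL X hX⟩)

/-- `loc^⊗(𝓜)`, the smallest localizing ideal containing a class `𝓜` of objects. -/
def generatedBy (𝓜 : Set T) : LocIdeal T := sInf {L | ∀ M ∈ 𝓜, L.prop M}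

end

end LocIdeal

/-- An idempotent algebra: a morphism `η : 𝟙 ⟶ A` such that `A ⊗ η` is an isomorphism. -/
structure IdempotentAlgebra (T : Type u) [Category.{v} T] [MonoidalCategory T] where
  obj : T
  unit : 𝟙_ T ⟶ obj
  idem : IsIso (obj ◁ unit)

/-- An idempotent coalgebra: a morphism `ε : C ⟶ 𝟙` such that `C ⊗ ε` is an isomorphism. -/
structure IdempotentCoalgebra (T : Type u) [Category.{v} T] [MonoidalCategory T] where
  obj : T
  counit : obj ⟶ 𝟙_ T
  idem : IsIso (obj ◁ counit)

section

variable {T : Type u} [Category.{v} T] [HasZeroObject T] [HasShift T ℤ]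
    [Preadditive T] [∀ n : ℤ, (shiftFunctor T n).Additive] [Pretriangulated T]
    [HasCoproducts.{v} T] [MonoidalCategory T]

/-- The idempotent algebra `A` corresponds to the ideal `L = ker (A ⊗ -)` of objects that it
annihilates. -/
def IdempotentAlgebra.Corresponds (A : IdempotentAlgebra T) (L : LocIdeal T) : Prop :=
  ∀ M : T, L.prop M ↔ IsZero (A.obj ⊗ M)

/-- The idempotent coalgebra `C` corresponds to the ideal `L = {M | C ⊗ M ≅ M}` of its
comodules. -/
def IdempotentCoalgebra.Corresponds (C : IdempotentCoalgebra T) (L : LocIdeal T) : Prop :=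
  ∀ M : T, L.prop M ↔ Nonempty (C.obj ⊗ M ≅ M)

/-- `L` belongs to `Idem(T)`, regarded as a subset of `Loc^⊗(T)`: it is the smashing ideal of an
idempotent algebra. -/
def LocIdeal.IsIdem (L : LocIdeal T) : Prop := ∃ A : IdempotentAlgebra T, A.Corresponds L

end

/-- A frame is spatial if it is isomorphic to the frame of open subsets of a space. -/
def IsSpatialFrame (F : Type w) [Order.Frame F] : Prop :=
  ∃ (X : Type w) (_ : TopologicalSpace X), Nonempty (F ≃o TopologicalSpace.Opens X)

/-- A space is `T_D` if every point is locally closed. -/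
def IsTDSpace (X : Type w) [TopologicalSpace X] : Prop := ∀ x : X, IsLocallyClosed ({x} : Set X)

/-- The open subset `U_f = {p | p(f) = 1}` of the space `pt(F)` of points of `F`. -/
def pointsOpen {F : Type w} [Order.Frame F] (f : F) : Set (Locale.PT F) := {p | p f}

section

variable {T : Type u} [Category.{v} T] [HasZeroObject T] [HasShift T ℤ]
    [Preadditive T] [∀ n : ℤ, (shiftFunctor T n).Additive] [Pretriangulated T]
    [HasCoproducts.{v} T] [MonoidalCategory T] {F : Type w} [Order.Frame F]

/-- `X` is (isomorphic to) an idempotent `Γ_p = C_{τ f} ⊗ A_{τ g}` at the point `p`, for some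
choice of `f, g` with `{p} = U_f ∩ V_g`, where `V_g` is the complement of `U_g`. -/
def IsIdempotentAt (τ : FrameHom F (LocIdeal T)) (p : Locale.PT F) (X : T) : Prop :=
  ∃ (f g : F) (C : IdempotentCoalgebra T) (A : IdempotentAlgebra T),
    ({p} : Set (Locale.PT F)) = pointsOpen f ∩ (pointsOpen g)ᶜ ∧
    C.Corresponds (τ f) ∧ A.Corresponds (τ g) ∧ Nonempty (X ≅ C.obj ⊗ A.obj)

/-- Weak discretizations of `τ`: injective join-preserving maps `υ : 𝒫(pt F) → Loc^⊗(T)` such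
that `υ(U_f) = ⋁_{x ∈ U_f} υ(x) ⊆ τ(f)` for all `f`. -/
structure IsWeakDiscretization (τ : FrameHom F (LocIdeal T))
    (υ : Set (Locale.PT F) → LocIdeal T) : Prop where
  map_sSup : ∀ 𝓦 : Set (Set (Locale.PT F)), υ (sSup 𝓦) = sSup (υ '' 𝓦)
  injective : Function.Injective υ
  open_eq : ∀ f : F, υ (pointsOpen f) = ⨆ x ∈ pointsOpen f, υ {x}
  open_le : ∀ f : F, υ (pointsOpen f) ≤ τ f

end

/-! The engine is that `A_{τg}` annihilates `τg`, so tensoring with it carries `L ⊔ τg` into `L`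
(`sup_le_colon`). Spatiality reduces inequalities in `F` to points, and `τ` carries them to ideals.
If `p ∈ U_h` and `{p} = U_f ∩ V_g`, then `f ≤ h ⊔ g`, whence `Γ_p ∈ τh`. If `q ≠ p` has data `f',
g'`, then `f ⊓ f' ≤ g ⊔ g'`, whence `C_{τf} ⊗ Γ_q ∈ τg`. So if the `Γ_q` with `q ≠ p` generated
`Γ_p`, then `C_{τf} ⊗ Γ_p ≅ Γ_p` would lie in `τg`. This forces `τf ≤ τg`, and `f ≤ g` by
injectivity of `τ`, contradicting `p ∈ U_f ∩ V_g`. Hence `υ(W)` determines `W`; preservation of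
joins is formal. -/

theorem mem_iff_of_pointsOpen_singleton {F : Type w} [Order.Frame F] {p q : Locale.PT F} {f g : F}
    (h : ({p} : Set (Locale.PT F)) = pointsOpen f ∩ (pointsOpen g)ᶜ) :
    (q f ∧ ¬ q g) ↔ q = p := by
  change q ∈ pointsOpen f ∩ (pointsOpen g)ᶜ ↔ q = p
  rw [← h, Set.mem_singleton_iff]

/-- In a spatial frame the order is detected by the points. -/
theorem IsSpatialFrame.le_of_points {F : Type w} [Order.Frame F] (hF : IsSpatialFrame F) {f g : F}
    (h : ∀ p : Locale.PT F, p f → p g) : f ≤ g := by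
  obtain ⟨X, _, ⟨e⟩⟩ := hF
  rw [← e.le_iff_le]
  intro x hx
  -- Each `x : X` gives the point of `F` that tests whether `x ∈ e f`.
  exact h ((Locale.localePointOfSpacePoint X x).comp (e : FrameHom F (TopologicalSpace.Opens X))) hx

theorem IsTDSpace.exists_pointsOpen {F : Type w} [Order.Frame F] (hD : IsTDSpace (Locale.PT F))
    (p : Locale.PT F) :
    ∃ f g : F, ({p} : Set (Locale.PT F)) = pointsOpen f ∩ (pointsOpen g)ᶜ := by
  obtain ⟨U, Z, hU, hZ, h⟩ := hD p
  obtain ⟨f, rfl⟩ := hU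
  obtain ⟨g, hg⟩ := hZ.isOpen_compl
  refine ⟨f, g, ?_⟩
  rw [h, show pointsOpen g = Zᶜ from hg, compl_compl]
  rfl

namespace LocIdeal

section

variable {T : Type u} [Category.{v} T] [HasZeroObject T] [HasShift T ℤ]
    [Preadditive T] [∀ n : ℤ, (shiftFunctor T n).Additive] [Pretriangulated T]
    [HasCoproducts.{v} T] [MonoidalCategory T]

theorem mem_of_iso (L : LocIdeal T) {X Y : T} (e : X ≅ Y) (h : L.prop X) : L.prop Y :=
  L.iso_closed.of_iso e h

theorem mem_of_isZero (L : LocIdeal T) {X : T} (h : IsZero X) : L.prop X :=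
  have := L.iso_closed
  have := L.triangulated
  L.prop.prop_of_isZero h

theorem subset_generatedBy {𝓜 : Set T} {M : T} (h : M ∈ 𝓜) : (generatedBy 𝓜).prop M :=
  fun _ hL => hL M h

theorem generatedBy_le {𝓜 : Set T} {L : LocIdeal T} : generatedBy 𝓜 ≤ L ↔ ∀ M ∈ 𝓜, L.prop M :=
  ⟨fun h M hM => h M (subset_generatedBy hM), fun h => sInf_le h⟩

theorem generatedBy_image_sSup {ι : Type*} (Γ : ι → T) (𝓦 : Set (Set ι)) :
    generatedBy (Γ '' sSup 𝓦) = sSup ((fun W => generatedBy (Γ '' W)) '' 𝓦) := by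
  refine eq_of_forall_ge_iff fun L => ?_
  simp only [generatedBy_le, sSup_le_iff, Set.forall_mem_image, Set.sSup_eq_sUnion,
    Set.mem_sUnion]
  exact ⟨fun h W hW x hx => h ⟨W, hW, hx⟩, fun h x ⟨W, hW, hx⟩ => h hW hx⟩

theorem generatedBy_image_eq_iSup {ι : Type*} (Γ : ι → T) (W : Set ι) :
    generatedBy (Γ '' W) = ⨆ x ∈ W, generatedBy (Γ '' {x}) := by
  refine eq_of_forall_ge_iff fun L => ?_
  simp only [generatedBy_le, iSup_le_iff, Set.forall_mem_image, Set.mem_singleton_iff,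
    forall_eq]

theorem tensor_mem_right [SymmetricCategory T] (L : LocIdeal T) (X M : T) (h : L.prop M) : L.prop (M ⊗ X) :=
  L.mem_of_iso (β_ X M) (L.tensor_mem X M h)

end

variable {T : Type u} [Category.{v} T] [HasZeroObject T] [HasShift T ℤ]
    [Preadditive T] [∀ n : ℤ, (shiftFunctor T n).Additive] [Pretriangulated T]
    [IsTriangulated T] [HasCoproducts.{v} T] [MonoidalCategory T] [SymmetricCategory T]

variable [BigTTCategory T]

/-- The colon ideal of all objects `M` with `X ⊗ M` in `L`. -/
def colon (L : LocIdeal T) (X : T) : LocIdeal T where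
  prop M := L.prop (X ⊗ M)
  iso_closed := ⟨fun e h => L.mem_of_iso (whiskerLeftIso X e) h⟩
  triangulated := by
    obtain ⟨_, _⟩ := BigTTCategory.tensor_exact X
    have := L.iso_closed
    have := L.triangulated
    exact inferInstanceAs (L.prop.inverseImage (tensorLeft X)).IsTriangulated
  coproduct_mem J M h := by
    have := BigTTCategory.tensor_coproducts X J
    exact L.mem_of_iso (PreservesCoproduct.iso (tensorLeft X) M).symm (L.coproduct_mem J _ h)
  tensor_mem Y M h :=
    L.mem_of_iso ((α_ Y X M).symm ≪≫ whiskerRightIso (β_ Y X) M ≪≫ α_ X Y M) (L.tensor_mem Y _ h)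

/-- Since the colon is a localizing ideal, it suffices to test `L` and `K` separately; no
description of the objects of the join is needed. -/
theorem sup_le_colon {L K : LocIdeal T} {A : IdempotentAlgebra T} (hA : A.Corresponds K) :
    L ⊔ K ≤ L.colon A.obj :=
  sup_le (fun M hM => L.tensor_mem _ M hM) (fun M hM => L.mem_of_isZero ((hA M).1 hM))

end LocIdeal

section

variable {T : Type u} [Category.{v} T] [HasZeroObject T] [HasShift T ℤ]
    [Preadditive T] [∀ n : ℤ, (shiftFunctor T n).Additive] [Pretriangulated T]
    [HasCoproducts.{v} T] [MonoidalCategory T]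

/-- The multiplication isomorphism of an idempotent algebra. -/
noncomputable def IdempotentAlgebra.mulIso (A : IdempotentAlgebra T) : A.obj ≅ A.obj ⊗ A.obj :=
  have := A.idem
  (ρ_ A.obj).symm ≪≫ asIso (A.obj ◁ A.unit)

/-- The comultiplication isomorphism of an idempotent coalgebra. -/
noncomputable def IdempotentCoalgebra.comulIso (C : IdempotentCoalgebra T) :
    C.obj ⊗ C.obj ≅ C.obj :=
  have := C.idem
  asIso (C.obj ◁ C.counit) ≪≫ ρ_ C.obj

theorem IdempotentCoalgebra.Corresponds.obj_mem {C : IdempotentCoalgebra T} {L : LocIdeal T}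
    (h : C.Corresponds L) : L.prop C.obj :=
  (h _).2 ⟨C.comulIso⟩

/-- As `A ⊗ A ≅ A`, an object `A ⊗ M` killed by `A` is already zero. -/
theorem IdempotentAlgebra.Corresponds.mem_of_tensor_mem {A : IdempotentAlgebra T} {L : LocIdeal T}
    (h : A.Corresponds L) {M : T} (hM : L.prop (A.obj ⊗ M)) : L.prop M :=
  (h M).2 (((h _).1 hM).of_iso (whiskerRightIso A.mulIso M ≪≫ α_ _ _ _))

theorem IdempotentCoalgebra.Corresponds.le_of_obj_mem [SymmetricCategory T] {C : IdempotentCoalgebra T}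
    {L K : LocIdeal T} (h : C.Corresponds L) (hC : K.prop C.obj) : L ≤ K := fun M hM =>
  have ⟨e⟩ := (h M).1 hM
  K.mem_of_iso e (K.tensor_mem_right _ _ hC)

end

section

variable {T : Type u} [Category.{v} T] [HasZeroObject T] [HasShift T ℤ]
    [Preadditive T] [∀ n : ℤ, (shiftFunctor T n).Additive] [Pretriangulated T]
    [IsTriangulated T] [HasCoproducts.{v} T] [MonoidalCategory T] [SymmetricCategory T]

variable [BigTTCategory T]

/-- Tensoring preserves distinguished triangles, up to the connecting morphism. -/
theorem BigTTCategory.exists_distinguished_tensor (X : T) {P Q R : T} {a : P ⟶ Q} {b : Q ⟶ R}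
    {c : R ⟶ (shiftFunctor T (1 : ℤ)).obj P}
    (h : Pretriangulated.Triangle.mk a b c ∈ Pretriangulated.distinguishedTriangles) :
    ∃ d, Pretriangulated.Triangle.mk (X ◁ a) (X ◁ b) d ∈
      Pretriangulated.distinguishedTriangles := by
  obtain ⟨_, _⟩ := BigTTCategory.tensor_exact X
  exact ⟨_, (tensorLeft X).map_distinguished _ h⟩

/-- The ideal of an idempotent algebra also corresponds to an idempotent coalgebra, the fibre of
the unit. -/
theorem LocIdeal.IsIdem.exists_coalgebra {L : LocIdeal T} (h : L.IsIdem) :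
    ∃ C : IdempotentCoalgebra T, C.Corresponds L := by
  obtain ⟨A, hA⟩ := h
  obtain ⟨C, ε, δ, hT⟩ := Pretriangulated.distinguished_cocone_triangle₁ A.unit
  have hAC : IsZero (A.obj ⊗ C) := by
    obtain ⟨d, hd⟩ := BigTTCategory.exists_distinguished_tensor A.obj hT
    exact Pretriangulated.Triangle.isZero₁_of_isIso₂ _ hd A.idem
  -- The case `M = C` gives idempotence of `ε`; the other cases give `C ⊗ M ≅ M` on the ideal.
  have hIso (M : T) (hM : IsZero (A.obj ⊗ M)) : IsIso (M ◁ ε) := by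
    obtain ⟨d, hd⟩ := BigTTCategory.exists_distinguished_tensor M hT
    exact (Pretriangulated.Triangle.isZero₃_iff_isIso₁ _ hd).1 (hM.of_iso (β_ M A.obj))
  refine ⟨⟨C, ε, hIso C hAC⟩, fun M => ⟨fun hM => ?_, fun ⟨e⟩ => ?_⟩⟩
  · have := hIso M ((hA M).1 hM)
    exact ⟨β_ C M ≪≫ asIso (M ◁ ε) ≪≫ ρ_ M⟩
  · exact L.mem_of_iso e (L.tensor_mem_right _ _ ((hA C).2 hAC))

variable {F : Type w} [Order.Frame F] {τ : FrameHom F (LocIdeal T)}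

theorem exists_isIdempotentAt (hD : IsTDSpace (Locale.PT F)) (hτ_idem : ∀ f : F, (τ f).IsIdem)
    (p : Locale.PT F) : ∃ X : T, IsIdempotentAt τ p X := by
  obtain ⟨f, g, h⟩ := hD.exists_pointsOpen p
  obtain ⟨C, hC⟩ := (hτ_idem f).exists_coalgebra
  obtain ⟨A, hA⟩ := hτ_idem g
  exact ⟨_, f, g, C, A, h, hC, hA, ⟨Iso.refl _⟩⟩

/-- The idempotent at `p` lies in `τ f` for every open neighbourhood `U_f` of `p`. -/
theorem IsIdempotentAt.mem_of_apply (hF : IsSpatialFrame F) {p : Locale.PT F} {X : T}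
    (hX : IsIdempotentAt τ p X) {f : F} (hp : p f) : (τ f).prop X := by
  obtain ⟨f', g, C, A, h, hC, hA, ⟨e⟩⟩ := hX
  -- A point of `U_f'` outside `U_g` can only be `p`, which lies in `U_f`.
  have hle : f' ≤ f ⊔ g := hF.le_of_points fun q hq => by
    rw [map_sup]
    by_cases hg : q g
    · exact Or.inr hg
    · obtain rfl := (mem_iff_of_pointsOpen_singleton h).1 ⟨hq, hg⟩
      exact Or.inl hp
  have hle' : τ f' ≤ τ f ⊔ τ g := by
    rw [← map_sup]
    exact OrderHomClass.mono τ hle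
  exact (τ f).mem_of_iso (β_ _ _ ≪≫ e.symm) (LocIdeal.sup_le_colon hA _ (hle' _ hC.obj_mem))

/-- Idempotents at distinct points are orthogonal. -/
theorem IsIdempotentAt.mem_colon_of_ne (hF : IsSpatialFrame F) {p q : Locale.PT F} (hpq : q ≠ p)
    {f g : F} (h : ({p} : Set (Locale.PT F)) = pointsOpen f ∩ (pointsOpen g)ᶜ)
    {C : IdempotentCoalgebra T} (hC : C.Corresponds (τ f)) {X : T} (hX : IsIdempotentAt τ q X) :
    ((τ g).colon C.obj).prop X := by
  obtain ⟨f', g', C', A', h', hC', hA', ⟨e⟩⟩ := hX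
  -- A point violating this would equal both `p` and `q`.
  have hle : f ⊓ f' ≤ g ⊔ g' := hF.le_of_points fun r hr => by
    rw [map_inf] at hr
    rw [map_sup]
    by_contra hg
    obtain ⟨hg, hg'⟩ := not_or.1 hg
    exact hpq (((mem_iff_of_pointsOpen_singleton h').1 ⟨hr.2, hg'⟩).symm.trans
      ((mem_iff_of_pointsOpen_singleton h).1 ⟨hr.1, hg⟩))
  have hle' : τ (f ⊓ f') ≤ τ g ⊔ τ g' := by
    rw [← map_sup]
    exact OrderHomClass.mono τ hle
  have hCC : (τ (f ⊓ f')).prop (C.obj ⊗ C'.obj) := by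
    -- Passing to the generated ideal turns membership in a meet into an inequality, so `le_inf`
    -- applies.
    have : LocIdeal.generatedBy {C.obj ⊗ C'.obj} ≤ τ (f ⊓ f') := by
      rw [map_inf]
      refine le_inf (LocIdeal.generatedBy_le.2 ?_) (LocIdeal.generatedBy_le.2 ?_) <;>
        rintro _ rfl
      · exact (τ f).tensor_mem_right _ _ hC.obj_mem
      · exact (τ f').tensor_mem _ _ hC'.obj_mem
    exact LocIdeal.generatedBy_le.1 this _ rfl
  exact (τ g).mem_of_iso (β_ _ _ ≪≫ α_ _ _ _ ≪≫ whiskerLeftIso C.obj e.symm)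
    (LocIdeal.sup_le_colon hA' _ (hle' _ hCC))

theorem IsIdempotentAt.notMem_generatedBy (hF : IsSpatialFrame F)
    (hτ_inj : Function.Injective τ) {Γ : Locale.PT F → T} (hΓ : ∀ p, IsIdempotentAt τ p (Γ p))
    {p : Locale.PT F} {W : Set (Locale.PT F)} (hp : p ∉ W) :
    ¬ (LocIdeal.generatedBy (Γ '' W)).prop (Γ p) := by
  intro hmem
  obtain ⟨f, g, C, A, h, hC, hA, ⟨e⟩⟩ := hΓ p
  have hle : LocIdeal.generatedBy (Γ '' W) ≤ (τ g).colon C.obj := by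
    rw [LocIdeal.generatedBy_le]
    rintro _ ⟨q, hq, rfl⟩
    exact (hΓ q).mem_colon_of_ne hF (ne_of_mem_of_not_mem hq hp) h hC
  have h₁ : (τ g).prop (C.obj ⊗ Γ p) := hle _ hmem
  have h₂ : (τ g).prop (A.obj ⊗ C.obj) :=
    (τ g).mem_of_iso (whiskerLeftIso C.obj e ≪≫ (α_ _ _ _).symm ≪≫
      whiskerRightIso C.comulIso A.obj ≪≫ β_ _ _) h₁
  -- The factor `A` cancels, leaving `C ∈ τ g`, and `C` generates `τ f`.
  have h₃ : τ f ≤ τ g := hC.le_of_obj_mem (hA.mem_of_tensor_mem h₂)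
  have h₄ : f ≤ g := by
    rw [← inf_eq_left]
    apply hτ_inj
    rw [map_inf, inf_eq_left]
    exact h₃
  obtain ⟨hf, hg⟩ := (mem_iff_of_pointsOpen_singleton h).2 rfl
  exact hg (OrderHomClass.mono p h₄ hf)

end

theorem mainTheorem6 {T : Type u} [Category.{v} T] [HasZeroObject T] [HasShift T ℤ]
    [Preadditive T] [∀ n : ℤ, (shiftFunctor T n).Additive] [Pretriangulated T]
    [IsTriangulated T] [HasCoproducts.{v} T] [MonoidalCategory T] [SymmetricCategory T]
    [BigTTCategory T] {F : Type w} [Order.Frame F] (hF : IsSpatialFrame F)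
    (hD : IsTDSpace (Locale.PT F)) (τ : FrameHom F (LocIdeal T))
    (hτ_inj : Function.Injective τ) (hτ_idem : ∀ f : F, (τ f).IsIdem) :
    (∀ p : Locale.PT F, ∃ X : T, IsIdempotentAt τ p X) ∧
    ∀ Γ : Locale.PT F → T, (∀ p, IsIdempotentAt τ p (Γ p)) →
      IsWeakDiscretization τ (fun W => LocIdeal.generatedBy (Γ '' W)) := by
  refine ⟨exists_isIdempotentAt hD hτ_idem, fun Γ hΓ => ⟨LocIdeal.generatedBy_image_sSup Γ, ?_,
    fun f => LocIdeal.generatedBy_image_eq_iSup Γ _, fun f => ?_⟩⟩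
  · have key {W W' : Set (Locale.PT F)}
        (h : LocIdeal.generatedBy (Γ '' W) = LocIdeal.generatedBy (Γ '' W')) : W ⊆ W' := by
      intro p hp
      by_contra hp'
      refine IsIdempotentAt.notMem_generatedBy hF hτ_inj hΓ hp' ?_
      rw [← h]
      exact LocIdeal.subset_generatedBy (Set.mem_image_of_mem Γ hp)
    exact fun W W' h => (key h).antisymm (key h.symm)
  · rw [LocIdeal.generatedBy_le]
    rintro _ ⟨p, hp, rfl⟩
    exact (hΓ p).mem_of_apply hF hp
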